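/- Throughout, for an integer sequence $A=(a_n)_{n\ge 1}$, a prime $p$ is a *primitive prime divisor* of $a_n$ if $p\mid a_n$ and $p\nmid a_m$ for every $1\le m<n$ with $a_m\neq 0$. The *Zsigmondy bound* $Z(A)$ is the largest $n$ such that $a_n$ has no primitive prime divisor, with $Z(A)=\infty$ if there are infinitely many such $n$, and with the convention $Z(A)=1$ if there is no such $n$. **Theorem 3.2.** Let $d$ be a squarefree positive integer, let $K=\mathbb{Q}(\sqrt d)\subset\mathbb{R}$ with ring of integers $R$, and let $u\in R$ be a unit with $u>1$ and $N_{K/\mathbb{Q}}(u)=-1$. Let $\Delta=(\Delta_n)_{n\ge 1}$ with $\Delta_n=N_{K/\mathbb{Q}}(u^n-1)$, and let $\Delta'=(\Delta'_n)_{n\ge1}$ be the sequence obtained from $\Delta$ by removing the terms $\Delta_n$ with $n\equiv 2 \pmod 4$ and renumbering the remaining terms consecutively (so $\Delta'_1=\Delta_1$, $\Delta'_2=\Delta_3$, $\Delta'_3=\Delta_4$, $\Delta'_4=\Delta_5$, $\Delta'_5=\Delta_7$, and so on). If $u>13$, then $Z(\Delta')\le 4$. If $u\le 13$, then exactly one of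 the following holds: - $u=1+\sqrt2$, $Z(\Delta')=3$, and the only term of $\Delta'$ without a primitive prime divisor is $\Delta'_3$; - $u=\frac{1+\sqrt5}{2}$, $Z(\Delta')=18$, and the only terms of $\Delta'$ without a primitive prime divisor are $\Delta'_9,\Delta'_{15},\Delta'_{18}$ and the trivial first term $\Delta'_1=-1$; - $u$ is neither of these two numbers, every term of $\Delta'$ has a primitive prime divisor, and $Z(\Delta')=1$. -/

import Mathlib

open scoped NumberField

noncomputable section

/-- A prime `p` is a primitive prime divisor of the `n`th term of the integer sequence
`A 1, A 2, A 3, …` (the value `A 0` is never used): `p` divides `A n` and divides no earlier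
nonzero term. -/
def IsPrimitivePrimeDivisor (A : ℕ → ℤ) (n p : ℕ) : Prop :=
  p.Prime ∧ (p : ℤ) ∣ A n ∧ ∀ m : ℕ, 1 ≤ m → m < n → A m ≠ 0 → ¬ (p : ℤ) ∣ A m

/-- The set of indices `n ≥ 1` for which the `n`th term of `A` has no primitive prime divisor. -/
def failureSet (A : ℕ → ℤ) : Set ℕ :=
  {n : ℕ | 1 ≤ n ∧ ¬ ∃ p : ℕ, IsPrimitivePrimeDivisor A n p}

open Classical in
/-- The Zsigmondy bound of `A`: the maximum of the set of indices of terms without a primitive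
prime divisor, and `∞` if that set is infinite. If every term has a primitive prime divisor, the
bound is `1` by convention. -/
def zsigmondyBound (A : ℕ → ℤ) : ℕ∞ :=
  if (failureSet A).Infinite then ⊤
  else if failureSet A = ∅ then 1
  else ((sSup (failureSet A) : ℕ) : ℕ∞)

/-- The field `ℚ(√d)`, as a subfield of `ℝ`. -/
abbrev QSqrt (d : ℕ) : IntermediateField ℚ ℝ :=
  IntermediateField.adjoin ℚ {√(d : ℝ)}

/-- `ℚ(√d)` is a number field; hence its ring of integers is a finite free `ℤ`-module and the
norm `Algebra.norm ℤ` on it is the usual field norm. -/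
instance instNumberFieldQSqrt (d : ℕ) : NumberField (QSqrt d) where
  to_charZero := inferInstance
  to_finiteDimensional := by
    apply IntermediateField.adjoin.finiteDimensional
    refine IsIntegral.of_pow (n := 2) (by norm_num) ?_
    rw [Real.sq_sqrt (Nat.cast_nonneg d)]
    simpa using (isIntegral_algebraMap (R := ℚ) (A := ℝ) (x := (d : ℚ)))

/-- The Lehmer-Pierce sequence `Δ_n = N_{K/ℚ}(α ^ n - 1)` associated to `α`. -/
def lehmerPierce {K : Type*} [Field K] (α : 𝓞 K) (n : ℕ) : ℤ :=
  Algebra.norm ℤ (α ^ n - 1)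

/-- The sequence obtained from `A 1, A 2, A 3, …` by removing the terms `A k` with
`k ≡ 2 (mod 4)` and renumbering the remaining terms `1, 2, 3, …`
(`Nat.nth P` enumerates the naturals satisfying `P` in increasing order, starting from `0`). -/
def removeTwoModFour (A : ℕ → ℤ) (n : ℕ) : ℤ :=
  A (Nat.nth (fun k => 1 ≤ k ∧ k % 4 ≠ 2) (n - 1))

end

/-! If `a` is the trace of `u`, then `u² = a u + 1`, and `Δ_n` depends only on `a ≥ 1`. Let `α, β`
be the roots of `X² - aX - 1`, and put `cycNorm a m = Φ_m(α²) Φ_m(β²)`. The surviving indices are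
the odd `m` and the `2m` with `m` even. A prime dividing `cycNorm a m` but not `m` is primitive at
that index, since modulo it `α²` or `β²` has exact order `m` (`primitive_of_dvd_cycNorm`).

Suppose instead that every prime factor of `cycNorm a m` divides `m`. Frobenius permutes the roots
modulo `p`, so the prime-to-`p` part of `m` divides `p ± 1`. Two such primes can therefore occur
only for `m = 6, 12` (`eq_six_or_twelve`). For other `m > 2` there is one prime `p`, its cube does
not divide, and `|cycNorm a m| ≤ p²` (`abs_cycNorm_le_sq`). But `|cycNorm a m| > (a²)^φ(m)`, which
is at least `4^(p-1) ≥ p²` once `a ≥ 2`. For `a = 1` that bound is empty and `Φ_n(x^p)` is estimated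
instead (`exists_prime_dvd_cycNorm_one`).

The remaining small indices are settled by explicit values. Failures occur only for `a = 1` (golden
ratio) and `a = 2` (`1 + √2`). -/

open Polynomial QuadraticAlgebra

/-! ### Norms from `ℤ[X]/(X² - aX - 1)` and Lucas sequences -/

/-- The norm `f(α) f(β)` where `α, β` are the roots of `X² - a X - 1`. -/
noncomputable def conjNorm (a : ℤ) (f : ℤ[X]) : ℤ :=
  QuadraticAlgebra.norm (aeval (ω : QuadraticAlgebra ℤ 1 a) f)

theorem conjNorm_mul (a : ℤ) (f g : ℤ[X]) : conjNorm a (f * g) = conjNorm a f * conjNorm a g := by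
  simp [conjNorm]

/-- `QuadraticAlgebra ℤ 1 a` is universal: `ω ↦ α` extends to a homomorphism sending `star ω = a -
ω` to `β`. One integer thus serves over `ℝ`, in characteristic `p`, and in the quadratic ring
itself. -/
theorem aeval_mul_aeval_eq_conjNorm {R : Type*} [CommRing R] {a : ℤ} {α β : R}
    (hs : α + β = a) (hp : α * β = -1) (f : ℤ[X]) :
    aeval α f * aeval β f = (conjNorm a f : R) := by
  have hα : α * α = (1 : ℤ) • (1 : R) + a • α := by
    rw [zsmul_eq_mul, zsmul_eq_mul, ← hs]
    linear_combination -hp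
  let φ := QuadraticAlgebra.lift (R := ℤ) (a := 1) (b := a) ⟨α, hα⟩
  have hφ : φ ω = α := by simp [φ, QuadraticAlgebra.lift]
  have hφ' : φ (star ω) = β := by
    have : star (ω : QuadraticAlgebra ℤ 1 a) = (a : QuadraticAlgebra ℤ 1 a) - ω := by
      ext <;> simp
    rw [this, map_sub, hφ, map_intCast, ← hs]; ring
  have key := congrArg φ (algebraMap_norm_eq_mul_star (aeval (ω : QuadraticAlgebra ℤ 1 a) f))
  have hstar : star (aeval (ω : QuadraticAlgebra ℤ 1 a) f) = aeval (star ω) f := by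
    have := Polynomial.hom_eval₂ f (algebraMap ℤ (QuadraticAlgebra ℤ 1 a))
      (starRingEnd (QuadraticAlgebra ℤ 1 a)) ω
    rw [aeval_def, aeval_def]
    rw [starRingEnd_apply, starRingEnd_apply] at this
    rw [this]
    congr 1
    exact RingHom.ext_int _ _
  rw [hstar, map_mul, ← aeval_algHom_apply φ ω, ← aeval_algHom_apply φ (star ω), hφ, hφ'] at key
  rw [← key]
  simp [conjNorm]

/-- The Lucas sequence of the second kind with parameters `(a, -1)`. -/
def lucasV (a : ℤ) : ℕ → ℤ
  | 0 => 2
  | 1 => a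
  | n + 2 => a * lucasV a (n + 1) + lucasV a n

/-- The Lucas sequence of the first kind with parameters `(a, -1)`. -/
def lucasU (a : ℤ) : ℕ → ℤ
  | 0 => 0
  | 1 => 1
  | n + 2 => a * lucasU a (n + 1) + lucasU a n

section
variable {R : Type*} [CommRing R] {a : ℤ} {α β : R}

theorem pow_add_pow_eq_lucasV (hs : α + β = a) (hp : α * β = -1) (n : ℕ) :
    α ^ n + β ^ n = (lucasV a n : R) := by
  induction n using Nat.twoStepInduction with
  | zero => norm_num [lucasV]
  | one => simpa [lucasV] using hs
  | more n h0 h1 =>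
    simp only [lucasV, Int.cast_add, Int.cast_mul, ← h0, ← h1, ← hs]
    linear_combination -(α ^ n + β ^ n) * hp

theorem pow_sub_pow_eq_lucasU (hs : α + β = a) (hp : α * β = -1) (n : ℕ) :
    α ^ n - β ^ n = (α - β) * (lucasU a n : R) := by
  induction n using Nat.twoStepInduction with
  | zero => norm_num [lucasU]
  | one => simp [lucasU]
  | more n h0 h1 =>
    simp only [lucasU, Int.cast_add, Int.cast_mul, mul_add, ← h0, ← hs, mul_left_comm (α - β)]
    rw [← h1]
    linear_combination (-α ^ n + β ^ n) * hp

end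

theorem omega_add_star (a : ℤ) : (ω : QuadraticAlgebra ℤ 1 a) + star ω = ((a : ℤ) : QuadraticAlgebra ℤ 1 a) := by
  ext <;> simp

theorem omega_mul_star (a : ℤ) : (ω : QuadraticAlgebra ℤ 1 a) * star ω = -1 := by
  ext <;> simp

theorem quadInt_cast_injective (a : ℤ) :
    Function.Injective (Int.cast : ℤ → QuadraticAlgebra ℤ 1 a) := fun x y h => by
  simpa using congrArg QuadraticAlgebra.re h

theorem conjNorm_X_pow_sub_one (a : ℤ) (n : ℕ) :
    conjNorm a (X ^ n - 1) = 1 + (-1) ^ n - lucasV a n := by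
  apply quadInt_cast_injective a
  rw [← aeval_mul_aeval_eq_conjNorm (omega_add_star a) (omega_mul_star a)]
  push_cast
  rw [← pow_add_pow_eq_lucasV (omega_add_star a) (omega_mul_star a), ← omega_mul_star a, mul_pow]
  simp only [map_sub, map_pow, aeval_X, map_one]
  ring

theorem lucasV_two_mul (a : ℤ) (n : ℕ) : lucasV a (2 * n) = lucasV a n ^ 2 - 2 * (-1) ^ n := by
  apply quadInt_cast_injective a
  push_cast
  rw [← pow_add_pow_eq_lucasV (omega_add_star a) (omega_mul_star a),
    ← pow_add_pow_eq_lucasV (omega_add_star a) (omega_mul_star a), ← omega_mul_star a, mul_pow]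
  ring

theorem lucasV_two_mul_sub (a : ℤ) (n : ℕ) :
    lucasV a (2 * n) = (a ^ 2 + 4) * lucasU a n ^ 2 + 2 * (-1) ^ n := by
  apply quadInt_cast_injective a
  have h := pow_sub_pow_eq_lucasU (omega_add_star a) (omega_mul_star a) n
  have hd : (ω - star ω) ^ 2 = (a : QuadraticAlgebra ℤ 1 a) ^ 2 + 4 := by
    rw [← omega_add_star a]
    linear_combination (-4) * omega_mul_star a
  push_cast
  rw [← hd, ← mul_pow, ← h, ← pow_add_pow_eq_lucasV (omega_add_star a) (omega_mul_star a),
    ← omega_mul_star a, mul_pow]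
  ring

/-! ### Cyclotomic norms and the order of `α²` modulo a prime -/

/-- The norm of `Φ_m(α²)`, where `α` is a root of `X² - a X - 1`. -/
noncomputable def cycNorm (a : ℤ) (m : ℕ) : ℤ :=
  conjNorm a (expand ℤ 2 (cyclotomic m ℤ))

section
variable {R : Type*} [CommRing R] {a : ℤ} {α β : R}

theorem eval_cyclotomic_mul_eval_eq_cycNorm (hs : α + β = a) (hp : α * β = -1) (m : ℕ) :
    (cyclotomic m R).eval (α ^ 2) * (cyclotomic m R).eval (β ^ 2) = (cycNorm a m : R) := by
  rw [cycNorm, ← aeval_mul_aeval_eq_conjNorm hs hp, expand_aeval, expand_aeval,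
    ← map_cyclotomic_int m R, eval_map, eval_map, aeval_def, aeval_def]
  rfl

end

theorem exists_roots_of_isAlgClosed (F : Type*) [Field F] [IsAlgClosed F] (a : ℤ) :
    ∃ α β : F, α + β = a ∧ α * β = -1 := by
  have hd : (X ^ 2 - C (a : F) * X - 1 : F[X]).degree ≠ 0 := by
    have : (X ^ 2 - C (a : F) * X - 1 : F[X]).degree = 2 := by compute_degree!
    rw [this]; norm_num
  obtain ⟨α, hα⟩ := IsAlgClosed.exists_root _ hd
  simp only [IsRoot.def, eval_sub, eval_pow, eval_X, eval_mul, eval_C, eval_one] at hα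
  exact ⟨α, a - α, by ring, by linear_combination -hα⟩

theorem exists_roots_isRoot_cyclotomic {a : ℤ} {m p : ℕ} [Fact p.Prime]
    (h : (p : ℤ) ∣ cycNorm a m) :
    ∃ α β : AlgebraicClosure (ZMod p), α + β = a ∧ α * β = -1 ∧
      (cyclotomic m (AlgebraicClosure (ZMod p))).IsRoot (α ^ 2) := by
  obtain ⟨α, β, hs, hp⟩ := exists_roots_of_isAlgClosed (AlgebraicClosure (ZMod p)) a
  have h0 := eval_cyclotomic_mul_eval_eq_cycNorm hs hp m
  rw [(CharP.intCast_eq_zero_iff (AlgebraicClosure (ZMod p)) p _).2 h, mul_eq_zero] at h0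
  rcases h0 with h0 | h0
  · exact ⟨α, β, hs, hp, h0⟩
  · exact ⟨β, α, by rw [add_comm, hs], by rw [mul_comm, hp], h0⟩

/-- A bijection from the natural numbers onto those that are odd or divisible by four. -/
def keptIndex (m : ℕ) : ℕ := if Odd m then m else 2 * m

theorem neg_one_pow_mul_pow_eq_one {F : Type*} [CommRing F] {α β : F} (hp : α * β = -1) (n : ℕ) :
    α ^ n * β ^ n = (-1) ^ n := by rw [← mul_pow, hp]

theorem pow_two_mul_eq_one_of_mul_eq_zero {F : Type*} [Field F] {α β : F} (hp : α * β = -1) {n : ℕ}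
    (h : (α ^ n - 1) * (β ^ n - 1) = 0) : α ^ (2 * n) = 1 := by
  have h1 := neg_one_pow_mul_pow_eq_one hp n
  rcases mul_eq_zero.1 h with h | h
  · rw [mul_comm, pow_mul, sub_eq_zero.1 h, one_pow]
  · rw [sub_eq_zero.1 h, mul_one] at h1
    rw [mul_comm, pow_mul, h1, ← pow_mul, mul_comm, pow_mul]; simp

theorem dvd_conjNorm_X_pow_sub_one_iff {a : ℤ} {p : ℕ} [Fact p.Prime]
    {α β : AlgebraicClosure (ZMod p)} (hs : α + β = a) (hp : α * β = -1) (n : ℕ) :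
    (p : ℤ) ∣ conjNorm a (X ^ n - 1) ↔ (α ^ n - 1) * (β ^ n - 1) = 0 := by
  rw [← CharP.intCast_eq_zero_iff (AlgebraicClosure (ZMod p)) p,
    ← aeval_mul_aeval_eq_conjNorm hs hp]
  simp

/-- A prime divisor of `cycNorm a m` not dividing `m` is primitive for the term of index
`keptIndex m`. -/
theorem primitive_of_dvd_cycNorm {a : ℤ} {m p : ℕ} (hpp : p.Prime)
    (h : (p : ℤ) ∣ cycNorm a m) (hpm : ¬ p ∣ m) :
    (p : ℤ) ∣ conjNorm a (X ^ keptIndex m - 1) ∧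
      ∀ j, 1 ≤ j → j < keptIndex m → j % 4 ≠ 2 → ¬ (p : ℤ) ∣ conjNorm a (X ^ j - 1) := by
  have : Fact p.Prime := ⟨hpp⟩
  obtain ⟨α, β, hs, hp, hroot⟩ := exists_roots_isRoot_cyclotomic h
  have : NeZero (m : AlgebraicClosure (ZMod p)) :=
    ⟨fun h0 => hpm ((CharP.cast_eq_zero_iff _ p m).1 h0)⟩
  have hprim : IsPrimitiveRoot (α ^ 2) m := isRoot_cyclotomic_iff.1 hroot
  have hα : α ^ (2 * m) = 1 := by rw [pow_mul, hprim.pow_eq_one]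
  simp only [dvd_conjNorm_X_pow_sub_one_iff hs hp]
  have hdvd : ∀ j, (α ^ j - 1) * (β ^ j - 1) = 0 → m ∣ j := fun j hj =>
    hprim.dvd_of_pow_eq_one j (by rw [← pow_mul, pow_two_mul_eq_one_of_mul_eq_zero hp hj])
  unfold keptIndex
  split_ifs with hm
  · refine ⟨?_, fun j h1 h2 _ hj => ?_⟩
    · have h1 := neg_one_pow_mul_pow_eq_one hp m
      rw [hm.neg_one_pow] at h1
      -- Either `α^m = 1`, or `α^m = -1` and then `β^m = 1` because `(αβ)^m = -1` for odd `m`.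
      have h2 : (α ^ m - 1) * (α ^ m + 1) = 0 := by
        rw [pow_mul'] at hα
        linear_combination hα
      rcases mul_eq_zero.1 h2 with h2 | h2
      · rw [h2, zero_mul]
      · rw [eq_neg_of_add_eq_zero_left h2] at h1 ⊢
        linear_combination (2 : AlgebraicClosure (ZMod p)) * h1
    · exact absurd (Nat.le_of_dvd h1 (hdvd j hj)) (by omega)
  · rw [Nat.not_odd_iff_even] at hm
    refine ⟨by rw [hα]; ring, fun j h1 h2 h3 hj => ?_⟩
    have hmj := hdvd j hj
    have hje : Even j := hm.trans_dvd hmj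
    -- The deletion of the indices `≡ 2 (mod 4)` enters here: with `j = 4i`, `α^j = 1` gives `m ∣
    -- 2i`, hence `2m ≤ j`.
    obtain ⟨i, rfl⟩ : 4 ∣ j := by
      obtain ⟨r, rfl⟩ := hje
      omega
    have h4 := neg_one_pow_mul_pow_eq_one hp (4 * i)
    rw [hje.neg_one_pow] at h4
    have hα4 : α ^ (4 * i) = 1 := by
      rcases mul_eq_zero.1 hj with hj | hj
      · exact sub_eq_zero.1 hj
      · rwa [sub_eq_zero.1 hj, mul_one] at h4
    have : m ∣ 2 * i := hprim.dvd_of_pow_eq_one _ (by rw [← pow_mul, ← hα4]; congr 1; ring)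
    exact absurd (Nat.le_of_dvd (by omega) this) (by omega)

/-- The prime-to-`p` part of `m` divides `p - 1` or `p + 1` when `p` divides `cycNorm a m`. -/
theorem dvd_sub_one_or_dvd_add_one {a : ℤ} {i m p : ℕ} (hpp : p.Prime)
    (h : (p : ℤ) ∣ cycNorm a (p ^ i * m)) (hpm : ¬ p ∣ m) : m ∣ p - 1 ∨ m ∣ p + 1 := by
  have : Fact p.Prime := ⟨hpp⟩
  obtain ⟨α, β, hs, hp, hroot⟩ := exists_roots_isRoot_cyclotomic h
  have : NeZero (m : AlgebraicClosure (ZMod p)) :=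
    ⟨fun h0 => hpm ((CharP.cast_eq_zero_iff _ p m).1 h0)⟩
  have hprim : IsPrimitiveRoot (α ^ 2) m := isRoot_cyclotomic_prime_pow_mul_iff_of_charP.1 hroot
  have hα0 : α ≠ 0 := by rintro rfl; simp at hp
  have hfrob : (α ^ p) * (α ^ p) = a * α ^ p + 1 := by
    have h1 : α * α = a * α + 1 := by rw [← hs]; linear_combination -hp
    have := congrArg (frobenius (AlgebraicClosure (ZMod p)) p) h1
    rw [map_mul, map_add, map_mul, map_one, map_intCast, frobenius_def] at this
    exact this
  -- By Frobenius `α^p` is again a root of `X² - aX - 1`. If it is `β`, then `α^(p+1) = -1`, and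
  -- squaring gives `(α²)^(p+1) = 1`.
  have h2 : (α ^ p - α) * (α ^ p - β) = 0 := by
    linear_combination hfrob - α ^ p * hs + hp
  rcases mul_eq_zero.1 h2 with h2 | h2
  · left
    apply hprim.dvd_of_pow_eq_one
    have : α ^ (p - 1) = 1 := by
      apply mul_right_cancel₀ hα0
      rw [← pow_succ, Nat.sub_add_cancel hpp.one_le, sub_eq_zero.1 h2, one_mul]
    rw [← pow_mul, mul_comm, pow_mul, this, one_pow]
  · right
    apply hprim.dvd_of_pow_eq_one
    have : α ^ (p + 1) = -1 := by rw [pow_succ, sub_eq_zero.1 h2, mul_comm, hp]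
    rw [← pow_mul, mul_comm, pow_mul, this]
    norm_num

/-! ### Cubes of primes dividing `m` do not divide the cyclotomic norm -/

theorem exists_geom_sum_one_add_X_eq {p : ℕ} (hp : p.Prime) :
    ∃ s : ℤ[X], ∑ i ∈ Finset.range p, (1 + X : ℤ[X]) ^ i =
      X ^ (p - 1) + (p : ℤ[X]) * (1 + X * s) := by
  obtain ⟨r, hr⟩ := exists_add_pow_prime_eq hp (1 : ℤ[X]) X
  have h1 : ∑ i ∈ Finset.range p, (1 + X : ℤ[X]) ^ i = X ^ (p - 1) + (p : ℤ[X]) * r := by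
    apply mul_right_cancel₀ (X_ne_zero (R := ℤ))
    have := geom_sum_mul (1 + X : ℤ[X]) p
    rw [add_sub_cancel_left] at this
    rw [this, hr, add_mul, ← pow_succ, Nat.sub_add_cancel hp.one_le]
    ring
  have h2 : r.eval 0 = 1 := by
    have := congrArg (eval 0) h1
    have hp1 : p - 1 ≠ 0 := by have := hp.two_le; omega
    simp only [eval_finsetSum, eval_pow, eval_add, eval_one, eval_X, add_zero, one_pow,
      Finset.sum_const, Finset.card_range, nsmul_eq_mul, mul_one, eval_mul, eval_natCast,
      zero_pow hp1, zero_add] at this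
    have hp0 : (p : ℤ) ≠ 0 := by exact_mod_cast hp.ne_zero
    exact (mul_left_cancel₀ hp0 (by rw [← this, mul_one])).symm
  obtain ⟨s, hs⟩ : X ∣ r - 1 := by
    rw [X_dvd_iff, coeff_zero_eq_eval_zero, eval_sub, h2]; simp
  exact ⟨s, by rw [h1, ← hs]; ring⟩

theorem cyclotomic_dvd_geom_sum {n p : ℕ} (hn : 0 < n) (hp : 1 < p) :
    cyclotomic (n * p) ℤ ∣ ∑ i ∈ Finset.range p, (X ^ n : ℤ[X]) ^ i := by
  have h := X_pow_sub_one_mul_cyclotomic_dvd_X_pow_sub_one_of_dvd ℤ (d := n) (n := n * p)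
    (by rw [Nat.mem_properDivisors]; exact ⟨dvd_mul_right _ _, by nlinarith⟩)
  have h2 := mul_geom_sum (X ^ n : ℤ[X]) p
  rw [← pow_mul] at h2
  rw [← h2] at h
  exact (mul_dvd_mul_iff_left (X_pow_sub_C_ne_zero hn (1 : ℤ))).1 (by simpa using h)

/-- In characteristic `p` the `p`-th power map is injective, so `(α²)^(np) = 1` already forces
`α^(2n) = β^(2n) = 1`. -/
theorem prime_dvd_lucasV_sub_two {a : ℤ} {n p : ℕ} (hpp : p.Prime)
    (h : (p : ℤ) ∣ cycNorm a (n * p)) : (p : ℤ) ∣ lucasV a (2 * n) - 2 := by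
  have : Fact p.Prime := ⟨hpp⟩
  obtain ⟨α, β, hs, hp, hroot⟩ := exists_roots_isRoot_cyclotomic h
  have h1 : (α ^ 2) ^ (n * p) = 1 := by
    have := hroot.dvd (cyclotomic.dvd_X_pow_sub_one (n * p) _)
    simpa [sub_eq_zero] using this
  have h2 : α ^ (2 * n) = 1 := by
    rw [pow_mul, ← sub_eq_zero]
    apply eq_zero_of_pow_eq_zero (n := p)
    rw [sub_pow_char, ← pow_mul, h1]; simp
  have h3 := neg_one_pow_mul_pow_eq_one hp (2 * n)
  rw [h2, pow_mul (-1 : AlgebraicClosure (ZMod p))] at h3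
  norm_num at h3
  rw [← CharP.intCast_eq_zero_iff (AlgebraicClosure (ZMod p)) p]
  push_cast
  rw [← pow_add_pow_eq_lucasV hs hp, h2, h3]
  norm_num

/-- `V_{2n} - 2` is `V_n²` for odd `n` and `(a² + 4) U_n²` for even `n`, and `-4` is not a square
modulo 3. -/
theorem nine_dvd_of_three_dvd {a : ℤ} {n : ℕ} (h : (3 : ℤ) ∣ lucasV a (2 * n) - 2) :
    (9 : ℤ) ∣ lucasV a (2 * n) - 2 := by
  have h3 : Prime (3 : ℤ) := Int.prime_three
  rcases Nat.even_or_odd n with hn | hn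
  · have e : lucasV a (2 * n) - 2 = (a ^ 2 + 4) * lucasU a n ^ 2 := by
      rw [lucasV_two_mul_sub, hn.neg_one_pow]; ring
    rw [e] at h ⊢
    rcases h3.dvd_or_dvd h with h | h
    · exfalso
      have : a % 3 = 0 ∨ a % 3 = 1 ∨ a % 3 = 2 := by omega
      rcases this with h' | h' | h' <;>
        simp [pow_two, Int.add_emod, Int.mul_emod, h', Int.dvd_iff_emod_eq_zero] at h
    · have := pow_dvd_pow_of_dvd (h3.dvd_of_dvd_pow h) 2
      exact (by simpa using this : (9 : ℤ) ∣ _).mul_left _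
  · have e : lucasV a (2 * n) - 2 = lucasV a n ^ 2 := by
      rw [lucasV_two_mul, hn.neg_one_pow]; ring
    rw [e] at h ⊢
    have := pow_dvd_pow_of_dvd (h3.dvd_of_dvd_pow h) 2
    simpa using this

theorem quadInt_mul_cancel {a : ℤ} {k : ℕ} (hk : k ≠ 0) {x y : QuadraticAlgebra ℤ 1 a}
    (h : (k : QuadraticAlgebra ℤ 1 a) * x = k * y) : x = y := by
  have h1 := congrArg QuadraticAlgebra.re h
  have h2 := congrArg QuadraticAlgebra.im h
  simp [hk] at h1 h2
  ext <;> assumption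

theorem prime_not_dvd_one_quadInt {a : ℤ} {p : ℕ} (hp : p.Prime) :
    ¬ (p : QuadraticAlgebra ℤ 1 a) ∣ 1 := by
  rintro ⟨x, hx⟩
  have h1 := congrArg QuadraticAlgebra.re hx
  simp at h1
  have : (p : ℤ) ∣ 1 := ⟨_, h1⟩
  exact hp.one_lt.ne' (by exact_mod_cast Int.eq_one_of_dvd_one (by positivity) this)

/-- For `p ≥ 5` the exponent is at least 4, so two factors `z` are available. For `p = 3` there is
only one, which is why `9 ∣ z` is needed. -/
theorem pow_prime_sub_one_of_sq_eq {S : Type*} [CommRing S] {p : ℕ} (hp : p.Prime) (hp2 : p ≠ 2)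
    {z : ℤ} (hz : (p : ℤ) ∣ z) (hz9 : p = 3 → 9 ∣ z) {θ v : S} (h : θ ^ 2 = v * z) :
    (p : S) ^ 2 ∣ θ ^ (p - 1) := by
  by_cases h3 : p = 3
  · subst h3
    obtain ⟨w, rfl⟩ := hz9 rfl
    rw [h]
    exact ⟨v * w, by push_cast; ring⟩
  · obtain ⟨w, rfl⟩ := hz
    have h5 : 4 ≤ p - 1 := by
      have := hp.two_le
      have : p ≠ 4 := by rintro rfl; norm_num at hp
      omega
    refine dvd_trans ?_ (pow_dvd_pow θ h5)
    exact ⟨(v * w) ^ 2, by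
      rw [show θ ^ 4 = (θ ^ 2) ^ 2 by ring, h]; push_cast; ring⟩

/-- Modulo `p` the element `v - 1` is nilpotent, so each factor is `p` times a unit modulo `p`, and
the product cannot absorb a third `p`. -/
theorem cube_ne_mul_of_dvd_sq {S : Type*} [CommRing S] {p v v' s s' t t' c : S}
    (hcancel : ∀ x y, p * x = p * y → x = y) (hp1 : ¬ p ∣ 1) (hv : v * v' = 1)
    (hsq : p ∣ (v - 1) ^ 2) : p ^ 3 * c ≠
      (p ^ 2 * t + p * (1 + (v - 1) * s)) * (p ^ 2 * t' + p * (1 + (v' - 1) * s')) := by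
  intro h
  have h1 : p * c = (p * t + (1 + (v - 1) * s)) * (p * t' + (1 + (v' - 1) * s')) :=
    hcancel _ _ (hcancel _ _ (by linear_combination h))
  obtain ⟨w, hw⟩ := hsq
  -- As `v' - 1 = -v'(v - 1)`, this `r` satisfies `(1 + (v-1)s)(1 + (v'-1)s') = 1 + (v-1)r`.
  set r := s - v' * s' - v' * (v - 1) * s * s' with hr
  have h2 : 1 + (v - 1) * r = p * (c - t * (p * t' + (1 + (v' - 1) * s')) -
      t' * (1 + (v - 1) * s)) := by
    rw [hr]
    linear_combination (-1 : S) * h1 - (s' + (v - 1) * s * s') * hv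
  have h3 : p ∣ v - 1 := by
    refine ⟨(v - 1) * (c - t * (p * t' + (1 + (v' - 1) * s')) - t' * (1 + (v - 1) * s)) - w * r, ?_⟩
    linear_combination (v - 1) * h2 - r * hw
  obtain ⟨y, hy⟩ := h3
  exact hp1 ⟨_ - y * r, by
    rw [mul_sub, ← h2]
    linear_combination -r * hy⟩

/-- Expand the geometric sum in `θ = v - 1` with `v = α^(2n)`. Since `vv' = 1`, `θ² = v(V_{2n} -
2)`, so `p²` divides `θ^(p-1)` and the sum is `p(1 + θs)` modulo `p²`. -/
theorem not_prime_cube_dvd_conjNorm_geom_sum {S : Type*} [CommRing S] {a : ℤ} {α β : S}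
    {n p : ℕ} (hs : α + β = a) (hp : α * β = -1)
    (hcancel : ∀ x y : S, (p : S) * x = p * y → x = y) (hp1 : ¬ (p : S) ∣ 1)
    (hpp : p.Prime) (hp2 : p ≠ 2)
    (hz : (p : ℤ) ∣ lucasV a (2 * n) - 2) :
    ¬ (p : ℤ) ^ 3 ∣ conjNorm a (expand ℤ 2 (∑ i ∈ Finset.range p, (X ^ n : ℤ[X]) ^ i)) := by
  rintro ⟨c, hc⟩
  have hz9 : p = 3 → 9 ∣ lucasV a (2 * n) - 2 := by
    rintro rfl
    exact nine_dvd_of_three_dvd (by exact_mod_cast hz)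
  obtain ⟨s, hgs⟩ := exists_geom_sum_one_add_X_eq hpp
  have hsum := pow_add_pow_eq_lucasV hs hp (2 * n)
  have hmul := neg_one_pow_mul_pow_eq_one hp (2 * n)
  have hcS := congrArg (Int.cast : ℤ → S) hc
  rw [← aeval_mul_aeval_eq_conjNorm hs hp] at hcS
  simp only [expand_aeval, map_sum, map_pow, aeval_X] at hcS
  simp only [← pow_mul α 2 n, ← pow_mul β 2 n] at hcS
  rw [(even_two_mul n).neg_one_pow] at hmul
  generalize α ^ (2 * n) = v at *
  generalize β ^ (2 * n) = v' at *
  have hzS : ((lucasV a (2 * n) - 2 : ℤ) : S) = v + v' - 2 := by rw [hsum]; push_cast; ring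
  generalize lucasV a (2 * n) - 2 = z at *
  have hθ : (v - 1) ^ 2 = v * z := by rw [hzS]; linear_combination -hmul
  have hθ' : (v' - 1) ^ 2 = v' * z := by rw [hzS]; linear_combination -hmul
  obtain ⟨t, ht⟩ := pow_prime_sub_one_of_sq_eq hpp hp2 hz hz9 hθ
  obtain ⟨t', ht'⟩ := pow_prime_sub_one_of_sq_eq hpp hp2 hz hz9 hθ'
  have hgeom : ∀ x : S, ∑ i ∈ Finset.range p, x ^ i =
      (x - 1) ^ (p - 1) + (p : S) * (1 + (x - 1) * aeval (x - 1) s) := by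
    intro x
    have := congrArg (aeval (x - 1)) hgs
    simpa using this
  rw [hgeom, hgeom, ht, ht'] at hcS
  push_cast at hcS
  refine cube_ne_mul_of_dvd_sq hcancel hp1 hmul ?_ hcS.symm
  rw [hθ]
  obtain ⟨w, rfl⟩ := hz
  exact ⟨v * w, by push_cast; ring⟩

theorem cycNorm_dvd {a : ℤ} {m : ℕ} {g : ℤ[X]} (h : cyclotomic m ℤ ∣ g) :
    cycNorm a m ∣ conjNorm a (expand ℤ 2 g) := by
  obtain ⟨c, rfl⟩ := h
  rw [map_mul, conjNorm_mul]
  exact Int.dvd_mul_right _ _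

theorem not_prime_cube_dvd_cycNorm {a : ℤ} {n p : ℕ} (hpp : p.Prime) (hp2 : p ≠ 2) (hn : 0 < n)
    (h : (p : ℤ) ∣ cycNorm a (n * p)) : ¬ (p : ℤ) ^ 3 ∣ cycNorm a (n * p) := by
  intro hcube
  have h0 := cyclotomic_dvd_geom_sum hn hpp.one_lt
  have h1 := Int.dvd_trans hcube (cycNorm_dvd (a := a) h0)
  have h2 := prime_dvd_lucasV_sub_two hpp h
  revert h1
  have h3 := prime_not_dvd_one_quadInt (a := a) hpp
  have h4 : ∀ x y : QuadraticAlgebra ℤ 1 a, (p : QuadraticAlgebra ℤ 1 a) * x = p * y → x = y :=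
    fun x y => quadInt_mul_cancel hpp.ne_zero
  have h5 := omega_add_star a
  have h6 := omega_mul_star a
  exact not_prime_cube_dvd_conjNorm_geom_sum h5 h6 h4 h3 hpp hp2 h2

theorem aeval_expand_geom_sum_two {R : Type*} [CommRing R] {a : ℤ} {α β : R}
    (hs : α + β = a) (hp : α * β = -1) (k : ℕ) :
    aeval α (expand ℤ 2 (∑ i ∈ Finset.range 2, (X ^ (2 * k) : ℤ[X]) ^ i)) *
      aeval β (expand ℤ 2 (∑ i ∈ Finset.range 2, (X ^ (2 * k) : ℤ[X]) ^ i)) =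
      ((lucasV a (2 * k) ^ 2 : ℤ) : R) := by
  have hmul := neg_one_pow_mul_pow_eq_one hp (2 * k)
  rw [(even_two_mul k).neg_one_pow] at hmul
  simp only [expand_aeval, map_add, map_pow, aeval_X, Finset.sum_range_succ, Finset.sum_range_zero]
  push_cast
  rw [← pow_add_pow_eq_lucasV hs hp]
  simp only [zero_add, pow_zero, pow_one, map_zero]
  linear_combination (α ^ (2 * k) * β ^ (2 * k) - 1) * hmul

/-- For `4 ∣ m` the norm of `Φ_m(α²)` divides the square of a Lucas number that is not a multiple
of four. -/
theorem not_eight_dvd_cycNorm {a : ℤ} {m : ℕ} (hm : 0 < m) (h4 : 4 ∣ m) :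
    ¬ (8 : ℤ) ∣ cycNorm a m := by
  intro h8
  obtain ⟨k, rfl⟩ := h4
  have hk : 0 < k := by omega
  have hdvd := cyclotomic_dvd_geom_sum (n := 2 * k) (p := 2) (by omega) one_lt_two
  rw [show 2 * k * 2 = 4 * k by ring] at hdvd
  have h1 := h8.trans (cycNorm_dvd (a := a) hdvd)
  have h2 := quadInt_cast_injective a ((aeval_mul_aeval_eq_conjNorm (omega_add_star a)
    (omega_mul_star a) _).symm.trans (aeval_expand_geom_sum_two (omega_add_star a)
    (omega_mul_star a) k))
  rw [h2, lucasV_two_mul] at h1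
  generalize lucasV a k = b at h1
  have h3 : (8 : ℤ) ∣ (b ^ 2 - 2) ^ 2 ∨ (8 : ℤ) ∣ (b ^ 2 + 2) ^ 2 := by
    rcases neg_one_pow_eq_or ℤ k with h | h <;> rw [h] at h1
    · left; simpa using h1
    · right; simpa using h1
  have h5 : ∀ b : ZMod 8, (b ^ 2 - 2) ^ 2 ≠ 0 ∧ (b ^ 2 + 2) ^ 2 ≠ 0 := by decide
  rcases h3 with h3 | h3
  · exact (h5 b).1 (by exact_mod_cast (ZMod.intCast_zmod_eq_zero_iff_dvd _ 8).2 h3)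
  · exact (h5 b).2 (by exact_mod_cast (ZMod.intCast_zmod_eq_zero_iff_dvd _ 8).2 h3)

/-! ### Archimedean bounds for cyclotomic norms -/

theorem abs_eval_cyclotomic_eq_prod {n : ℕ} (hn : 0 < n) (z : ℝ) :
    |(cyclotomic n ℝ).eval z| = ∏ μ ∈ primitiveRoots n ℂ, ‖(z : ℂ) - μ‖ := by
  have h1 : (((cyclotomic n ℝ).eval z : ℝ) : ℂ) = (cyclotomic n ℂ).eval (z : ℂ) := by
    rw [← map_cyclotomic n Complex.ofRealHom, eval_map, ← Complex.ofRealHom_eq_coe,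
      ← Complex.ofRealHom_eq_coe, eval₂_at_apply]
  rw [← Real.norm_eq_abs, ← Complex.norm_real, h1,
    cyclotomic_eq_prod_X_sub_primitiveRoots (Complex.isPrimitiveRoot_exp n hn.ne'), eval_prod,
    norm_prod]
  simp

theorem abs_sub_one_pow_totient_le {n : ℕ} (hn : 0 < n) {z : ℝ} (hz : 0 ≤ z) :
    |z - 1| ^ n.totient ≤ |(cyclotomic n ℝ).eval z| := by
  rw [abs_eval_cyclotomic_eq_prod hn, ← Complex.card_primitiveRoots n, ← Finset.prod_const]
  refine Finset.prod_le_prod (fun _ _ => abs_nonneg _) fun μ hμ => ?_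
  have h1 : ‖μ‖ = 1 := ((mem_primitiveRoots hn).1 hμ).norm'_eq_one hn.ne'
  have := abs_norm_sub_norm_le (z : ℂ) μ
  rwa [h1, Complex.norm_real, Real.norm_of_nonneg hz] at this

theorem abs_eval_cyclotomic_le {n : ℕ} (hn : 0 < n) {z : ℝ} (hz : 0 ≤ z) :
    |(cyclotomic n ℝ).eval z| ≤ (z + 1) ^ n.totient := by
  rw [abs_eval_cyclotomic_eq_prod hn, ← Complex.card_primitiveRoots n, ← Finset.prod_const]
  refine Finset.prod_le_prod (fun _ _ => norm_nonneg _) fun μ hμ => ?_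
  have h1 : ‖μ‖ = 1 := ((mem_primitiveRoots hn).1 hμ).norm'_eq_one hn.ne'
  have := norm_sub_le (z : ℂ) μ
  rwa [h1, Complex.norm_real, Real.norm_of_nonneg hz] at this

section
variable {v w : ℝ}

theorem pow_totient_le_abs_mul {n : ℕ} (hn : 0 < n) (hv : 1 < v) (hvw : v * w = 1) :
    (v + w - 2) ^ n.totient ≤ |(cyclotomic n ℝ).eval v * (cyclotomic n ℝ).eval w| := by
  have hw : 0 < w := by by_contra h; nlinarith
  have hw1 : w < 1 := by by_contra h; nlinarith
  have e : v + w - 2 = |v - 1| * |w - 1| := by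
    rw [abs_of_pos (by linarith), abs_of_neg (by linarith)]; linear_combination hvw
  rw [e, mul_pow, abs_mul]
  exact mul_le_mul (abs_sub_one_pow_totient_le hn (by linarith))
    (abs_sub_one_pow_totient_le hn hw.le) (by positivity) (by positivity)

/-- Strictness matters at `a = 1`, where the left side becomes 1: the norm still has a prime factor.
-/
theorem pow_totient_lt_abs_mul {n : ℕ} (hn : 2 ≤ n) (hv : 1 < v) (hvw : v * w = 1) :
    (v + w - 2) ^ n.totient < |(cyclotomic n ℝ).eval v * (cyclotomic n ℝ).eval w| := by
  have hw : 0 < w := by by_contra h; nlinarith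
  have hw1 : w < 1 := by by_contra h; nlinarith
  have e : v + w - 2 = (v - 1) * |w - 1| := by
    rw [abs_of_neg (by linarith)]; linear_combination hvw
  rw [e, mul_pow, abs_mul]
  exact mul_lt_mul ((sub_one_pow_totient_lt_cyclotomic_eval hn hv).trans_le (le_abs_self _))
    (abs_sub_one_pow_totient_le (by omega) hw.le)
    (pow_pos (abs_pos.2 (by linarith)) _) (by positivity)

theorem abs_mul_le_pow_totient {n : ℕ} (hn : 0 < n) (hv : 1 < v) (hvw : v * w = 1) :
    |(cyclotomic n ℝ).eval v * (cyclotomic n ℝ).eval w| ≤ (v + w + 2) ^ n.totient := by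
  have hw : 0 < w := by by_contra h; nlinarith
  have e : v + w + 2 = (v + 1) * (w + 1) := by linear_combination -hvw
  rw [e, mul_pow, abs_mul]
  exact mul_le_mul (abs_eval_cyclotomic_le hn (by linarith))
    (abs_eval_cyclotomic_le hn hw.le) (by positivity) (by positivity)

end

theorem exists_real_roots {a : ℤ} (ha : 1 ≤ a) :
    ∃ α β : ℝ, α + β = a ∧ α * β = -1 ∧ 1 < α := by
  have ha' : (1 : ℝ) ≤ a := by exact_mod_cast ha
  have hs : √((a : ℝ) ^ 2 + 4) ^ 2 = (a : ℝ) ^ 2 + 4 := Real.sq_sqrt (by positivity)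
  have h1 : 1 < √((a : ℝ) ^ 2 + 4) := by
    rw [Real.lt_sqrt (by norm_num)]; nlinarith
  refine ⟨(a + √((a : ℝ) ^ 2 + 4)) / 2, (a - √((a : ℝ) ^ 2 + 4)) / 2, by ring, ?_, by linarith⟩
  linear_combination (-1 / 4) * hs

theorem pow_totient_lt_abs_cycNorm {a : ℤ} (ha : 1 ≤ a) {n : ℕ} (hn : 2 ≤ n) :
    (a ^ 2) ^ n.totient < |cycNorm a n| := by
  obtain ⟨α, β, hs, hp, hα⟩ := exists_real_roots ha
  have hab := eval_cyclotomic_mul_eval_eq_cycNorm hs hp n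
  have := pow_totient_lt_abs_mul hn (one_lt_pow₀ hα two_ne_zero)
    (show α ^ 2 * β ^ 2 = 1 by rw [← mul_pow, hp]; norm_num)
  rw [hab, show α ^ 2 + β ^ 2 - 2 = (a : ℝ) ^ 2 by
    rw [← hs]; linear_combination (-2) * hp] at this
  exact_mod_cast this

theorem abs_cycNorm_le {a : ℤ} (ha : 1 ≤ a) {n : ℕ} (hn : 0 < n) :
    |cycNorm a n| ≤ (a ^ 2 + 4) ^ n.totient := by
  obtain ⟨α, β, hs, hp, hα⟩ := exists_real_roots ha
  have hab := eval_cyclotomic_mul_eval_eq_cycNorm hs hp n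
  have := abs_mul_le_pow_totient hn (one_lt_pow₀ hα two_ne_zero)
    (show α ^ 2 * β ^ 2 = 1 by rw [← mul_pow, hp]; norm_num)
  rw [hab, show α ^ 2 + β ^ 2 + 2 = (a : ℝ) ^ 2 + 4 by
    rw [← hs]; linear_combination (-2) * hp] at this
  exact_mod_cast this

/-- Replacing `α²` by `α^(2k)` raises the base from `a²` to `V_{2k} - 2`, which is large even for `a
= 1`. -/
theorem pow_totient_le_abs_conjNorm_expand {a : ℤ} (ha : 1 ≤ a) {n k : ℕ} (hn : 0 < n)
    (hk : 0 < k) : (lucasV a (2 * k) - 2) ^ n.totient ≤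
      |conjNorm a (expand ℤ 2 (expand ℤ k (cyclotomic n ℤ)))| := by
  obtain ⟨α, β, hs, hp, hα⟩ := exists_real_roots ha
  have h1 : ∀ x : ℝ, aeval x (expand ℤ 2 (expand ℤ k (cyclotomic n ℤ))) =
      (cyclotomic n ℝ).eval (x ^ (2 * k)) := by
    intro x
    rw [expand_aeval, expand_aeval, ← map_cyclotomic_int n ℝ, eval_map, aeval_def, pow_mul]
    rfl
  have hab := aeval_mul_aeval_eq_conjNorm hs hp (expand ℤ 2 (expand ℤ k (cyclotomic n ℤ)))
  rw [h1, h1] at hab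
  have := pow_totient_le_abs_mul hn (one_lt_pow₀ hα (by omega : 2 * k ≠ 0))
    (show α ^ (2 * k) * β ^ (2 * k) = 1 by rw [← mul_pow, hp]; simp)
  rw [hab, pow_add_pow_eq_lucasV hs hp] at this
  exact_mod_cast this

theorem pow_totient_le_abs_cycNorm_of_dvd {a : ℤ} (ha : 1 ≤ a) {n p : ℕ} (hn : 0 < n)
    (hp : p.Prime) (hpn : p ∣ n) :
    (lucasV a (2 * p) - 2) ^ n.totient ≤ |cycNorm a (n * p)| := by
  have := pow_totient_le_abs_conjNorm_expand ha hn hp.pos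
  rwa [cyclotomic_expand_eq_cyclotomic hp hpn] at this

theorem pow_totient_le_abs_cycNorm_mul_of_not_dvd {a : ℤ} (ha : 1 ≤ a) {n p : ℕ} (hn : 0 < n)
    (hp : p.Prime) (hpn : ¬ p ∣ n) :
    (lucasV a (2 * p) - 2) ^ n.totient ≤ |cycNorm a (n * p)| * |cycNorm a n| := by
  have := pow_totient_le_abs_conjNorm_expand ha hn hp.pos
  rwa [cyclotomic_expand_eq_cyclotomic_mul hp hpn, map_mul, conjNorm_mul, abs_mul] at this

/-! ### Explicit values and prime factors for small `m` -/

theorem cycNorm_one_index {a : ℤ} (ha : 1 ≤ a) : cycNorm a 1 = -a ^ 2 := by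
  obtain ⟨α, β, hs, hp, -⟩ := exists_real_roots ha
  have h := eval_cyclotomic_mul_eval_eq_cycNorm hs hp 1
  simp only [cyclotomic_one, eval_sub, eval_X, eval_one] at h
  have : (cycNorm a 1 : ℝ) = -(a : ℝ) ^ 2 := by
    rw [← h, ← hs]; linear_combination (α * β + 1) * hp
  exact_mod_cast this

theorem cycNorm_two {a : ℤ} (ha : 1 ≤ a) : cycNorm a 2 = a ^ 2 + 4 := by
  obtain ⟨α, β, hs, hp, -⟩ := exists_real_roots ha
  have h := eval_cyclotomic_mul_eval_eq_cycNorm hs hp 2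
  simp only [cyclotomic_two, eval_add, eval_X, eval_one] at h
  have : (cycNorm a 2 : ℝ) = (a : ℝ) ^ 2 + 4 := by
    rw [← h, ← hs]; linear_combination (α * β - 3) * hp
  exact_mod_cast this

theorem cycNorm_three {a : ℤ} (ha : 1 ≤ a) : cycNorm a 3 = (a ^ 2 + 3) ^ 2 := by
  obtain ⟨α, β, hs, hp, -⟩ := exists_real_roots ha
  have h := eval_cyclotomic_mul_eval_eq_cycNorm hs hp 3
  simp only [cyclotomic_three, eval_add, eval_X, eval_pow, eval_one] at h
  have : (cycNorm a 3 : ℝ) = ((a : ℝ) ^ 2 + 3) ^ 2 := by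
    have hα : α ≠ 0 := by rintro rfl; simp at hp
    rw [← h, ← hs, show β = -1 / α by field_simp; linear_combination hp]
    field_simp; ring
  exact_mod_cast this

theorem cycNorm_five {a : ℤ} (ha : 1 ≤ a) : cycNorm a 5 = (a ^ 4 + 5 * a ^ 2 + 5) ^ 2 := by
  obtain ⟨α, β, hs, hp, -⟩ := exists_real_roots ha
  have h := eval_cyclotomic_mul_eval_eq_cycNorm hs hp 5
  have : Fact (Nat.Prime 5) := ⟨by norm_num⟩
  rw [cyclotomic_prime, eval_geom_sum, eval_geom_sum] at h
  simp only [Finset.sum_range_succ, Finset.sum_range_zero] at h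
  have : (cycNorm a 5 : ℝ) = ((a : ℝ) ^ 4 + 5 * (a : ℝ) ^ 2 + 5) ^ 2 := by
    have hα : α ≠ 0 := by rintro rfl; simp at hp
    rw [← h, ← hs, show β = -1 / α by field_simp; linear_combination hp]
    field_simp; ring
  exact_mod_cast this

theorem cycNorm_six {a : ℤ} (ha : 1 ≤ a) : cycNorm a 6 = (a ^ 2 + 1) ^ 2 := by
  obtain ⟨α, β, hs, hp, -⟩ := exists_real_roots ha
  have h := eval_cyclotomic_mul_eval_eq_cycNorm hs hp 6
  simp only [cyclotomic_six, eval_add, eval_sub, eval_X, eval_pow, eval_one] at h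
  have : (cycNorm a 6 : ℝ) = ((a : ℝ) ^ 2 + 1) ^ 2 := by
    have hα : α ≠ 0 := by rintro rfl; simp at hp
    rw [← h, ← hs, show β = -1 / α by field_simp; linear_combination hp]
    field_simp; ring
  exact_mod_cast this

theorem cycNorm_twelve {a : ℤ} (ha : 1 ≤ a) : cycNorm a 12 = (a ^ 4 + 4 * a ^ 2 + 1) ^ 2 := by
  obtain ⟨α, β, hs, hp, -⟩ := exists_real_roots ha
  have h := eval_cyclotomic_mul_eval_eq_cycNorm hs hp 12
  have h12 := cyclotomic_expand_eq_cyclotomic (p := 2) (n := 6) Nat.prime_two (by norm_num) ℝ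
  norm_num at h12
  simp only [← h12, eval_add, eval_sub, eval_X, eval_pow,
    eval_one] at h
  have : (cycNorm a 12 : ℝ) = ((a : ℝ) ^ 4 + 4 * (a : ℝ) ^ 2 + 1) ^ 2 := by
    have hα : α ≠ 0 := by rintro rfl; simp at hp
    rw [← h, ← hs, show β = -1 / α by field_simp; linear_combination hp]
    field_simp; ring
  exact_mod_cast this

theorem dvd_twentyFour_of_prime_dvd {n : ℕ} (h : ∀ q : ℕ, q.Prime → q ∣ n → q = 2 ∨ q = 3)
    (h16 : ¬ 16 ∣ n) (h9 : ¬ 9 ∣ n) : n ∣ 24 := by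
  rw [Nat.dvd_iff_prime_pow_dvd_dvd]
  intro q k hq hk
  rcases Nat.eq_zero_or_pos k with rfl | hk0
  · simp
  rcases h q hq ((dvd_pow_self q hk0.ne').trans hk) with rfl | rfl
  · have : k < 4 := by
      by_contra hc
      exact h16 ((pow_dvd_pow 2 (not_lt.1 hc)).trans hk)
    interval_cases k <;> norm_num
  · have : k < 2 := by
      by_contra hc
      exact h9 ((pow_dvd_pow 3 (not_lt.1 hc)).trans hk)
    interval_cases k; norm_num

/-- Used at `m = 2, 6, 12`, where a prime other than 2 and 3 cannot divide `m`. Congruences modulo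
16 and 9 bound the 2- and 3-parts. -/
theorem exists_prime_dvd_of_not_dvd_twentyFour {c : ℤ} (h16 : ¬ (16 : ℤ) ∣ c) (h9 : ¬ (9 : ℤ) ∣ c)
    (h24 : ¬ c ∣ 24) : ∃ q : ℕ, q.Prime ∧ (q : ℤ) ∣ c ∧ q ≠ 2 ∧ q ≠ 3 := by
  by_contra! hcon
  apply h24
  have := dvd_twentyFour_of_prime_dvd (n := c.natAbs)
    (fun q hq hqc => by
      by_contra! hne
      exact hne.2 (hcon q hq (Int.natCast_dvd.2 hqc) hne.1))
    (fun h => h16 (Int.natCast_dvd.2 h)) (fun h => h9 (Int.natCast_dvd.2 h))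
  exact Int.dvd_natAbs.1 (Int.natAbs_dvd.1 (by exact_mod_cast this))

theorem exists_prime_dvd_sq_add_four {a : ℤ} (ha : 1 ≤ a) (h2 : a ≠ 2) :
    ∃ q : ℕ, q.Prime ∧ (q : ℤ) ∣ a ^ 2 + 4 ∧ q ≠ 2 ∧ q ≠ 3 := by
  apply exists_prime_dvd_of_not_dvd_twentyFour
  · intro h
    have key : ∀ b : ZMod 16, b ^ 2 + 4 ≠ 0 := by decide
    exact key a (by exact_mod_cast (ZMod.intCast_zmod_eq_zero_iff_dvd _ 16).2 h)
  · intro h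
    have key : ∀ b : ZMod 9, b ^ 2 + 4 ≠ 0 := by decide
    exact key a (by exact_mod_cast (ZMod.intCast_zmod_eq_zero_iff_dvd _ 9).2 h)
  · intro h
    have := Int.le_of_dvd (by norm_num) h
    have : a < 5 := by nlinarith
    interval_cases a <;> omega

theorem exists_prime_dvd_sq_add_one {a : ℤ} (ha : 2 ≤ a) :
    ∃ q : ℕ, q.Prime ∧ (q : ℤ) ∣ a ^ 2 + 1 ∧ q ≠ 2 ∧ q ≠ 3 := by
  apply exists_prime_dvd_of_not_dvd_twentyFour
  · intro h
    have key : ∀ b : ZMod 16, b ^ 2 + 1 ≠ 0 := by decide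
    exact key a (by exact_mod_cast (ZMod.intCast_zmod_eq_zero_iff_dvd _ 16).2 h)
  · intro h
    have key : ∀ b : ZMod 9, b ^ 2 + 1 ≠ 0 := by decide
    exact key a (by exact_mod_cast (ZMod.intCast_zmod_eq_zero_iff_dvd _ 9).2 h)
  · intro h
    have := Int.le_of_dvd (by norm_num) h
    have : a < 5 := by nlinarith
    interval_cases a <;> omega

theorem exists_prime_dvd_pow_four_add {a : ℤ} (ha : 2 ≤ a) :
    ∃ q : ℕ, q.Prime ∧ (q : ℤ) ∣ a ^ 4 + 4 * a ^ 2 + 1 ∧ q ≠ 2 ∧ q ≠ 3 := by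
  apply exists_prime_dvd_of_not_dvd_twentyFour
  · intro h
    have key : ∀ b : ZMod 16, b ^ 4 + 4 * b ^ 2 + 1 ≠ 0 := by decide
    exact key a (by exact_mod_cast (ZMod.intCast_zmod_eq_zero_iff_dvd _ 16).2 h)
  · intro h
    have key : ∀ b : ZMod 9, b ^ 4 + 4 * b ^ 2 + 1 ≠ 0 := by decide
    exact key a (by exact_mod_cast (ZMod.intCast_zmod_eq_zero_iff_dvd _ 9).2 h)
  · intro h
    have := Int.le_of_dvd (by norm_num) h
    nlinarith [mul_self_nonneg (a ^ 2)]

theorem lucasV_one_growth {n : ℕ} (hn : 2 ≤ n) :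
    7 ≤ lucasV 1 (2 * n) ∧ lucasV 1 (2 * n) < lucasV 1 (2 * n + 1) := by
  induction n, hn using Nat.le_induction with
  | base => decide
  | succ n hn ih =>
    have e : ∀ k, lucasV 1 (k + 2) = 1 * lucasV 1 (k + 1) + lucasV 1 k := fun _ => rfl
    rw [show 2 * (n + 1) + 1 = 2 * n + 1 + 2 by ring, show 2 * (n + 1) = 2 * n + 2 by ring, e, e, e]
    constructor <;> linarith [ih.1, ih.2]

/-- The 5 is `a² + 4` at `a = 1`, the base of the upper bound in `abs_cycNorm_le`. -/
theorem five_mul_sq_lt_lucasV {n : ℕ} (hn : 7 ≤ n) : 5 * (n : ℤ) ^ 2 + 2 < lucasV 1 (2 * n) := by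
  induction n, hn using Nat.le_induction with
  | base => decide
  | succ n hn ih =>
    have e : lucasV 1 (2 * n + 2) = 1 * lucasV 1 (2 * n + 1) + lucasV 1 (2 * n) := rfl
    have := (lucasV_one_growth (by omega : 2 ≤ n)).2
    rw [show 2 * (n + 1) = 2 * n + 2 by ring, e]
    have hn' : (7 : ℤ) ≤ n := by exact_mod_cast hn
    push_cast
    nlinarith

/-! ### Existence of a prime factor not dividing `m` -/

theorem dvd_sub_one_or_dvd_add_one_of_prime_dvd {a : ℤ} {m p q : ℕ} (hm : 0 < m) (hp : p.Prime)
    (hq : q.Prime) (hpq : p ≠ q) (h : (p : ℤ) ∣ cycNorm a m) (hqm : q ∣ m) :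
    q ∣ p - 1 ∨ q ∣ p + 1 := by
  obtain ⟨i, n, hn, rfl⟩ := Nat.exists_eq_pow_mul_and_not_dvd hm.ne' p hp.ne_one
  have hqn : q ∣ n := (((Nat.coprime_primes hq hp).2 hpq.symm).pow_right i).dvd_of_dvd_mul_left hqm
  exact (dvd_sub_one_or_dvd_add_one hp h hn).imp hqn.trans hqn.trans

/-- The larger prime divides `p ± 1`, so `q = p + 1` and the primes are 2 and 3. Then the odd part
of `m` divides 3, and the 2-part divides `3 ± 1`. -/
theorem eq_six_or_twelve_of_lt {a : ℤ} {m p q : ℕ} (hm : 0 < m) (hp : p.Prime) (hq : q.Prime)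
    (hpq : p < q) (hpN : (p : ℤ) ∣ cycNorm a m) (hqN : (q : ℤ) ∣ cycNorm a m)
    (hpm : p ∣ m) (hqm : q ∣ m) : m = 6 ∨ m = 12 := by
  have h1 : q = p + 1 := by
    have := hp.two_le
    rcases dvd_sub_one_or_dvd_add_one_of_prime_dvd hm hp hq hpq.ne hpN hqm with h | h <;>
    · have := Nat.le_of_dvd (by omega) h
      omega
  obtain rfl : p = 2 := by
    rcases hp.eq_two_or_odd with h | h
    · exact h
    · have := hp.two_le
      rcases hq.eq_two_or_odd with h' | h' <;> omega
  subst h1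
  obtain ⟨i, n, hn, rfl⟩ := Nat.exists_eq_pow_mul_and_not_dvd hm.ne' 2 (by norm_num)
  have h3n : 3 ∣ n := (Nat.Coprime.pow_right i (by norm_num)).dvd_of_dvd_mul_left hqm
  have hn3 : n = 3 := by
    rcases dvd_sub_one_or_dvd_add_one hp hpN hn with h | h
    · have := Nat.le_of_dvd (by norm_num) h
      have := Nat.le_of_dvd (Nat.pos_of_ne_zero (by rintro rfl; simp at hn)) h3n
      omega
    · exact Nat.dvd_antisymm h h3n
  subst hn3
  have h4 : ¬ 3 ∣ 2 ^ i := fun h => by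
    have := Nat.prime_three.dvd_of_dvd_pow h
    omega
  have h5 := dvd_sub_one_or_dvd_add_one (i := 1) (m := 2 ^ i) hq
    (by rw [pow_one, mul_comm]; exact hqN) h4
  have h6 : 2 ^ i ≤ 2 ^ 2 := by
    rcases h5 with h | h <;> have := Nat.le_of_dvd (by norm_num) h <;> omega
  have h7 := (Nat.pow_le_pow_iff_right one_lt_two).1 h6
  interval_cases i
  · norm_num at hpm
  · left; norm_num
  · right; norm_num

theorem eq_six_or_twelve {a : ℤ} {m p q : ℕ} (hm : 0 < m) (hp : p.Prime) (hq : q.Prime)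
    (hpq : p ≠ q) (hpN : (p : ℤ) ∣ cycNorm a m) (hqN : (q : ℤ) ∣ cycNorm a m)
    (hpm : p ∣ m) (hqm : q ∣ m) : m = 6 ∨ m = 12 := by
  rcases hpq.lt_or_gt with h | h
  · exact eq_six_or_twelve_of_lt hm hp hq h hpN hqN hpm hqm
  · exact eq_six_or_twelve_of_lt hm hq hp h hqN hpN hqm hpm

theorem not_prime_cube_dvd_cycNorm_of_dvd {a : ℤ} {m p : ℕ} (hm : 0 < m) (hp : p.Prime)
    (hpN : (p : ℤ) ∣ cycNorm a m) (hpm : p ∣ m) (h2 : m ≠ 2) (h6 : m ≠ 6) :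
    ¬ (p : ℤ) ^ 3 ∣ cycNorm a m := by
  by_cases hp2 : p = 2
  · subst hp2
    refine not_eight_dvd_cycNorm hm ?_
    obtain ⟨i, n, hn, rfl⟩ := Nat.exists_eq_pow_mul_and_not_dvd hm.ne' 2 (by norm_num)
    -- The odd part of `m` divides 3, so an even `m` other than 2 and 6 is a multiple of 4.
    have hi : 2 ≤ i := by
      by_contra! hi
      have hn3 : n ∣ 3 := by
        rcases dvd_sub_one_or_dvd_add_one hp hpN hn with h | h
        · exact h.trans (by norm_num)
        · exact h
      rcases (Nat.dvd_prime Nat.prime_three).1 hn3 with rfl | rfl <;> interval_cases i <;> simp_all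
    exact ((pow_dvd_pow 2 hi).mul_right n)
  · obtain ⟨n, rfl⟩ := hpm
    rw [mul_comm] at hpN ⊢
    exact not_prime_cube_dvd_cycNorm hp hp2 (Nat.pos_of_mul_pos_left hm) hpN

theorem sub_one_le_totient {m p : ℕ} (hm : 0 < m) (hp : p.Prime) (hpm : p ∣ m) :
    p - 1 ≤ m.totient := by
  rw [← Nat.totient_prime hp]
  exact Nat.le_of_dvd (Nat.totient_pos.2 hm) (Nat.totient_dvd_of_dvd hpm)

theorem sq_le_four_pow {p : ℕ} (hp : 1 ≤ p) : (p : ℤ) ^ 2 ≤ 4 ^ (p - 1) := by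
  have h : p - 1 < 2 ^ (p - 1) := Nat.lt_two_pow_self
  have h1 : (p : ℤ) ≤ 2 ^ (p - 1) := by exact_mod_cast (by omega : p ≤ 2 ^ (p - 1))
  calc (p : ℤ) ^ 2 ≤ (2 ^ (p - 1)) ^ 2 := pow_le_pow_left₀ (by positivity) h1 2
    _ = 4 ^ (p - 1) := by rw [← pow_mul, mul_comm, pow_mul]; norm_num

/-- If every prime factor of `cycNorm a m` divides `m`, then `cycNorm a m` is, up to sign, a power
of a single prime `p` with exponent at most two. -/
theorem abs_cycNorm_le_sq {a : ℤ} {m : ℕ} (ha : 1 ≤ a) (hm : 2 < m) (h6 : m ≠ 6) (h12 : m ≠ 12)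
    (h : ∀ q : ℕ, q.Prime → (q : ℤ) ∣ cycNorm a m → q ∣ m) :
    ∃ p : ℕ, p.Prime ∧ p ∣ m ∧ (p : ℤ) ∣ cycNorm a m ∧ |cycNorm a m| ≤ (p : ℤ) ^ 2 := by
  have hlt := pow_totient_lt_abs_cycNorm ha (by omega : 2 ≤ m)
  have h1 : 1 < |cycNorm a m| := lt_of_le_of_lt (one_le_pow₀ (one_le_pow₀ ha)) hlt
  have h1' : (cycNorm a m).natAbs ≠ 1 := by
    rw [← Int.natCast_natAbs] at h1; exact_mod_cast h1.ne'
  have h0 : (cycNorm a m).natAbs ≠ 0 := by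
    rw [← Int.natCast_natAbs] at h1; omega
  obtain ⟨p, hp, hpN⟩ := Nat.exists_prime_and_dvd h1'
  have hpN' : (p : ℤ) ∣ cycNorm a m := Int.natCast_dvd.2 hpN
  have hpm := h p hp hpN'
  refine ⟨p, hp, hpm, hpN', ?_⟩
  have hpow := Nat.eq_prime_pow_of_unique_prime_dvd h0 (p := p) (fun {q} hq hqN => by
    by_contra hne
    have hqN' : (q : ℤ) ∣ cycNorm a m := Int.natCast_dvd.2 hqN
    rcases eq_six_or_twelve (by omega) hp hq (Ne.symm hne) hpN' hqN' hpm (h q hq hqN') with h | h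
    · exact h6 h
    · exact h12 h)
  generalize (cycNorm a m).natAbs.primeFactorsList.length = e at hpow
  have he : e ≤ 2 := by
    by_contra! he
    apply not_prime_cube_dvd_cycNorm_of_dvd (by omega) hp hpN' hpm (by omega) h6
    have : p ^ 3 ∣ (cycNorm a m).natAbs := hpow ▸ pow_dvd_pow p he
    exact_mod_cast Int.natCast_dvd.2 this
  rw [← Int.natCast_natAbs, hpow]
  exact_mod_cast Nat.pow_le_pow_right hp.pos he

theorem exists_prime_dvd_cycNorm_of_two_le {a : ℤ} {m : ℕ} (ha : 2 ≤ a) (hm : 2 < m) (h6 : m ≠ 6)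
    (h12 : m ≠ 12) : ∃ q : ℕ, q.Prime ∧ (q : ℤ) ∣ cycNorm a m ∧ ¬ q ∣ m := by
  by_contra! hcon
  obtain ⟨p, hp, hpm, -, hle⟩ := abs_cycNorm_le_sq (by omega) hm h6 h12 hcon
  have hlt := pow_totient_lt_abs_cycNorm (by omega : 1 ≤ a) (by omega : 2 ≤ m)
  have h4 : (4 : ℤ) ≤ a ^ 2 := by nlinarith
  have h1 : (4 : ℤ) ^ (p - 1) ≤ (a ^ 2) ^ m.totient :=
    (pow_le_pow_left₀ (by norm_num) h4 _).trans
      (pow_le_pow_right₀ (by linarith) (sub_one_le_totient (by omega) hp hpm))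
  linarith [sq_le_four_pow hp.one_le]

/-- With `m = np`, `Φ_n(x^p)` equals `Φ_{np}(x)` if `p ∣ n` and `Φ_{np}(x) Φ_n(x)` otherwise. The
second case yields `(V_{2p} - 2)^φ(n) ≤ p² 5^φ(n)`, impossible for `p ≥ 7`; for smaller `p`, `n ∣ p
± 1` leaves finitely many pairs. -/
theorem exists_prime_dvd_cycNorm_one {m : ℕ} (hm : 2 < m) (h3 : m ≠ 3) (h5 : m ≠ 5) (h6 : m ≠ 6)
    (h10 : m ≠ 10) (h12 : m ≠ 12) :
    ∃ q : ℕ, q.Prime ∧ (q : ℤ) ∣ cycNorm 1 m ∧ ¬ q ∣ m := by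
  by_contra! hcon
  obtain ⟨p, hp, hpm, hpN, hle⟩ := abs_cycNorm_le_sq le_rfl hm h6 h12 hcon
  obtain ⟨n, rfl⟩ := hpm
  rw [mul_comm] at *
  have hn : 0 < n := Nat.pos_of_ne_zero (by rintro rfl; simp at hm)
  by_cases hpn : p ∣ n
  · have h1 := pow_totient_le_abs_cycNorm_of_dvd le_rfl hn hp hpn
    have h2 : (4 : ℤ) < lucasV 1 (2 * p) - 2 := by linarith [(lucasV_one_growth hp.two_le).1]
    have h3 := sub_one_le_totient hn hp hpn
    have h4 : (4 : ℤ) ^ (p - 1) < (lucasV 1 (2 * p) - 2) ^ n.totient :=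
      (pow_lt_pow_left₀ h2 (by norm_num) (by have := hp.two_le; omega)).trans_le
        (pow_le_pow_right₀ (by linarith) h3)
    linarith [sq_le_four_pow hp.one_le]
  · have h1 := pow_totient_le_abs_cycNorm_mul_of_not_dvd le_rfl hn hp hpn
    have h2 := abs_cycNorm_le (a := 1) le_rfl hn
    have hdiv := dvd_sub_one_or_dvd_add_one (i := 1) hp (by rwa [pow_one, mul_comm]) hpn
    have h4 : (lucasV 1 (2 * p) - 2) ^ n.totient ≤ (p : ℤ) ^ 2 * 5 ^ n.totient :=
      h1.trans (mul_le_mul hle (by simpa using h2) (abs_nonneg _) (by positivity))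
    have ht : 1 ≤ n.totient := Nat.totient_pos.2 hn
    rcases Nat.lt_or_ge p 7 with h7 | h7
    · have h2p := hp.two_le
      have hn7 : n ≤ 7 := by
        rcases hdiv with h | h <;> have := Nat.le_of_dvd (by omega) h <;> omega
      interval_cases p <;> interval_cases n <;> first
        | omega
        | (norm_num at hp; done)
        | (revert h4; decide)
    · have h8 := five_mul_sq_lt_lucasV h7
      have hp1 : (1 : ℤ) ≤ (p : ℤ) ^ 2 := one_le_pow₀ (by exact_mod_cast hp.one_le)
      have h9 : (5 * (p : ℤ) ^ 2) ^ n.totient < (lucasV 1 (2 * p) - 2) ^ n.totient :=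
        pow_lt_pow_left₀ (by linarith) (by positivity) (by omega)
      rw [mul_pow] at h9
      have h10 : (p : ℤ) ^ 2 ≤ ((p : ℤ) ^ 2) ^ n.totient := le_self_pow₀ hp1 (by omega)
      have h11 : (0 : ℤ) < 5 ^ n.totient := by positivity
      nlinarith

theorem exists_prime_dvd_cycNorm {a : ℤ} {m : ℕ} (ha : 1 ≤ a) (hm : 0 < m)
    (h2 : a = 2 → m ≠ 2) (h1 : a = 1 → m ≠ 1 ∧ m ≠ 6 ∧ m ≠ 10 ∧ m ≠ 12) :
    ∃ q : ℕ, q.Prime ∧ (q : ℤ) ∣ cycNorm a m ∧ ¬ q ∣ m := by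
  have key : ∀ q : ℕ, q.Prime → q ≠ 2 → q ≠ 3 → ¬ q ∣ 12 := by
    intro q hq hq2 hq3 h
    rw [show 12 = 2 ^ 2 * 3 by norm_num, hq.dvd_mul] at h
    rcases h with h | h
    · exact hq2 ((Nat.prime_dvd_prime_iff_eq hq Nat.prime_two).1 (hq.dvd_of_dvd_pow h))
    · exact hq3 ((Nat.prime_dvd_prime_iff_eq hq Nat.prime_three).1 h)
  rcases (by omega : m = 1 ∨ m = 2 ∨ 2 < m) with rfl | rfl | hm2
  · obtain ⟨q, hq, hqa⟩ := Int.exists_prime_and_dvd (n := a) (by omega)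
    refine ⟨q.natAbs, Int.prime_iff_natAbs_prime.1 hq, ?_,
      fun h => (Int.prime_iff_natAbs_prime.1 hq).one_lt.ne' (Nat.dvd_one.1 h)⟩
    rw [cycNorm_one_index ha, Int.natAbs_dvd]
    exact (dvd_neg.2 (dvd_pow hqa two_ne_zero))
  · obtain ⟨q, hq, hqa, hq2, hq3⟩ := exists_prime_dvd_sq_add_four ha (fun h => h2 h rfl)
    exact ⟨q, hq, by rwa [cycNorm_two ha], fun h => key q hq hq2 hq3 (h.trans (by norm_num))⟩
  by_cases hm6 : m = 6
  · subst hm6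
    obtain ⟨q, hq, hqa, hq2, hq3⟩ := exists_prime_dvd_sq_add_one (a := a) (by omega)
    exact ⟨q, hq, by rw [cycNorm_six ha]; exact dvd_pow hqa two_ne_zero,
      fun h => key q hq hq2 hq3 (h.trans (by norm_num))⟩
  by_cases hm12 : m = 12
  · subst hm12
    obtain ⟨q, hq, hqa, hq2, hq3⟩ := exists_prime_dvd_pow_four_add (a := a) (by omega)
    exact ⟨q, hq, by rw [cycNorm_twelve ha]; exact dvd_pow hqa two_ne_zero, key q hq hq2 hq3⟩
  rcases ha.eq_or_lt with rfl | ha2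
  -- The size estimate does not exclude `m = 3, 5` when `a = 1`, but the norms there are `16` and
  -- `121`.
  · by_cases hm3 : m = 3
    · subst hm3
      exact ⟨2, Nat.prime_two, by rw [cycNorm_three ha]; norm_num, by norm_num⟩
    by_cases hm5 : m = 5
    · subst hm5
      exact ⟨11, by norm_num, by rw [cycNorm_five ha]; norm_num, by norm_num⟩
    exact exists_prime_dvd_cycNorm_one hm2 hm3 hm5 hm6 (h1 rfl).2.2.1 hm12
  · exact exists_prime_dvd_cycNorm_of_two_le ha2 hm2 hm6 hm12

/-! ### Exceptional indices -/

theorem keptIndex_surjective {k : ℕ} (hk : 1 ≤ k) (hk2 : k % 4 ≠ 2) :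
    ∃ m, 0 < m ∧ keptIndex m = k := by
  rcases Nat.even_or_odd k with h | h
  · obtain ⟨i, hi⟩ : 4 ∣ k := by
      obtain ⟨r, rfl⟩ := h
      omega
    refine ⟨2 * i, by omega, ?_⟩
    rw [keptIndex, if_neg (Nat.not_odd_iff_even.2 (even_two_mul i)), hi]
    ring
  · exact ⟨k, hk, by rw [keptIndex, if_pos h]⟩

/-- The indices `k ≥ 1`, `k ≢ 2 (mod 4)`, for which `N(u ^ k - 1)`, where `u ^ 2 = a u + 1`, has no
primitive prime divisor. -/
def exceptionalIndices (a : ℤ) : Set ℕ :=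
  {k | a = 2 ∧ k = 4 ∨ a = 1 ∧ (k = 1 ∨ k = 12 ∨ k = 20 ∨ k = 24)}

theorem exists_primitive_of_not_exceptional {a : ℤ} (ha : 1 ≤ a) {k : ℕ} (hk : 1 ≤ k)
    (hk2 : k % 4 ≠ 2) (he : k ∉ exceptionalIndices a) :
    ∃ p : ℕ, p.Prime ∧ (p : ℤ) ∣ conjNorm a (X ^ k - 1) ∧
      ∀ j, 1 ≤ j → j < k → j % 4 ≠ 2 → conjNorm a (X ^ j - 1) ≠ 0 →
        ¬ (p : ℤ) ∣ conjNorm a (X ^ j - 1) := by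
  obtain ⟨m, hm, rfl⟩ := keptIndex_surjective hk hk2
  obtain ⟨q, hq, hqN, hqm⟩ := exists_prime_dvd_cycNorm ha hm
    (by rintro rfl rfl; exact he (Or.inl ⟨rfl, by decide⟩))
    (by
      rintro rfl
      refine ⟨?_, ?_, ?_, ?_⟩ <;> rintro rfl <;> exact he (Or.inr ⟨rfl, by decide⟩))
  obtain ⟨h1, h2⟩ := primitive_of_dvd_cycNorm hq hqN hqm
  exact ⟨q, hq, h1, fun j h3 h4 h5 _ => h2 j h3 h4 h5⟩

theorem prime_dvd_of_dvd_mul_pow {p r s e f : ℕ} (hp : p.Prime) {t : ℤ}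
    (ht : t.natAbs = r ^ e * s ^ f) (hr : r.Prime) (hs : s.Prime) (h : (p : ℤ) ∣ t) :
    p = r ∨ p = s := by
  rw [Int.natCast_dvd, ht, hp.dvd_mul] at h
  exact h.imp (fun h => (Nat.prime_dvd_prime_iff_eq hp hr).1 (hp.dvd_of_dvd_pow h))
    (fun h => (Nat.prime_dvd_prime_iff_eq hp hs).1 (hp.dvd_of_dvd_pow h))

/-- For `a = 2`, `Δ_4 = -2⁵` and `Δ_1 = -2`. For `a = 1`, `Δ_1 = -1`, `Δ_12 = -2⁶·5`, `Δ_20 =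
-5³·11²`, `Δ_24 = -2⁸·9·45`, whose primes occur in `Δ_3 = -4`, `Δ_4 = -5`, `Δ_5 = -11`, `Δ_8 = -45`.
-/
theorem not_primitive_of_exceptional {a : ℤ} {k p : ℕ} (he : k ∈ exceptionalIndices a)
    (hp : p.Prime) (hpk : (p : ℤ) ∣ conjNorm a (X ^ k - 1)) :
    ∃ j, 1 ≤ j ∧ j < k ∧ j % 4 ≠ 2 ∧ conjNorm a (X ^ j - 1) ≠ 0 ∧
      (p : ℤ) ∣ conjNorm a (X ^ j - 1) := by
  simp only [conjNorm_X_pow_sub_one] at *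
  rcases he with ⟨rfl, rfl⟩ | ⟨rfl, rfl | rfl | rfl | rfl⟩
  · rcases prime_dvd_of_dvd_mul_pow (r := 2) (s := 2) (e := 2) (f := 3) hp (by decide)
      Nat.prime_two Nat.prime_two hpk with rfl | rfl <;> exact ⟨1, by decide⟩
  · exact absurd (Nat.dvd_one.1 (Int.natCast_dvd.1 hpk)) hp.ne_one
  · rcases prime_dvd_of_dvd_mul_pow (r := 2) (s := 5) (e := 6) (f := 1) hp (by decide)
      Nat.prime_two Nat.prime_five hpk with rfl | rfl
    · exact ⟨3, by decide⟩
    · exact ⟨4, by decide⟩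
  · rcases prime_dvd_of_dvd_mul_pow (r := 5) (s := 11) (e := 3) (f := 2) hp (by decide)
      Nat.prime_five (by norm_num) hpk with rfl | rfl
    · exact ⟨4, by decide⟩
    · exact ⟨5, by decide⟩
  · have h : (p : ℤ) ∣ 2 ∨ (p : ℤ) ∣ 45 := by
      have : (1 + (-1) ^ 24 - lucasV 1 24 : ℤ) = -(2 ^ 8 * (9 * 45)) := by decide
      rw [this, dvd_neg] at hpk
      have hp' := Nat.prime_iff_prime_int.1 hp
      rcases hp'.dvd_or_dvd hpk with h | h
      · exact Or.inl (hp'.dvd_of_dvd_pow h)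
      · rcases hp'.dvd_or_dvd h with h | h
        · exact Or.inr (h.trans (by norm_num))
        · exact Or.inr h
    rcases h with h | h
    · exact ⟨3, by decide, by decide, by decide, by decide, h.trans (by decide)⟩
    · exact ⟨8, by decide, by decide, by decide, by decide, h.trans (by decide)⟩

/-! ### Renumbering and the failure sets -/

theorem infinite_kept : (Set.ofPred (fun k : ℕ => 1 ≤ k ∧ k % 4 ≠ 2)).Infinite := by
  refine Set.infinite_of_not_bddAbove fun ⟨b, hb⟩ => ?_
  have := hb (show 4 * b + 1 ∈ Set.ofPred (fun k : ℕ => 1 ≤ k ∧ k % 4 ≠ 2) from ⟨by omega, by omega⟩)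
  omega

theorem mem_failureSet_removeTwoModFour_iff (A : ℕ → ℤ) (n : ℕ) :
    n ∈ failureSet (removeTwoModFour A) ↔ 1 ≤ n ∧
      ¬ ∃ p : ℕ, p.Prime ∧ (p : ℤ) ∣ A (Nat.nth (fun k => 1 ≤ k ∧ k % 4 ≠ 2) (n - 1)) ∧
        ∀ j, 1 ≤ j → j < Nat.nth (fun k => 1 ≤ k ∧ k % 4 ≠ 2) (n - 1) → j % 4 ≠ 2 → A j ≠ 0 →
          ¬ (p : ℤ) ∣ A j := by
  unfold failureSet IsPrimitivePrimeDivisor removeTwoModFour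
  simp only [Set.mem_ofPred_eq]
  refine and_congr_right fun hn => not_congr (exists_congr fun p => and_congr_right fun hp =>
    and_congr_right fun hpA => ⟨fun h j h1 h2 h3 => ?_, fun h m h1 h2 => ?_⟩)
  · have hj : Nat.nth (fun k => 1 ≤ k ∧ k % 4 ≠ 2)
        (Nat.count (fun k => 1 ≤ k ∧ k % 4 ≠ 2) j + 1 - 1) = j := Nat.nth_count ⟨h1, h3⟩
    -- `Nat.nth` counts from 0, so the original index `j` sits at position `count + 1`.
    have := h (Nat.count (fun k => 1 ≤ k ∧ k % 4 ≠ 2) j + 1) (by omega)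
    rw [hj] at this
    apply this
    have h4 : Nat.count (fun k => 1 ≤ k ∧ k % 4 ≠ 2) j < n - 1 :=
      (Nat.nth_lt_nth infinite_kept).1 (by
        rw [Nat.add_sub_cancel] at hj
        rwa [hj])
    omega
  · have h3 := Nat.nth_mem_of_infinite infinite_kept (m - 1)
    exact h _ h3.1 ((Nat.nth_lt_nth infinite_kept).2 (by omega)) h3.2

theorem nth_kept_eq_iff {n k : ℕ} (hn : 1 ≤ n) (hk : 1 ≤ k ∧ k % 4 ≠ 2) :
    Nat.nth (fun k => 1 ≤ k ∧ k % 4 ≠ 2) (n - 1) = k ↔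
      n = Nat.count (fun k => 1 ≤ k ∧ k % 4 ≠ 2) k + 1 := by
  constructor
  · rintro rfl
    rw [Nat.count_nth_of_infinite infinite_kept]
    omega
  · rintro rfl
    exact Nat.nth_count hk

theorem mem_failureSet_iff {a : ℤ} (ha : 1 ≤ a) (n : ℕ) :
    n ∈ failureSet (removeTwoModFour fun k => conjNorm a (X ^ k - 1)) ↔
      1 ≤ n ∧ Nat.nth (fun k => 1 ≤ k ∧ k % 4 ≠ 2) (n - 1) ∈ exceptionalIndices a := by
  rw [mem_failureSet_removeTwoModFour_iff]
  refine and_congr_right fun _ => ⟨fun h => ?_, fun h => ?_⟩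
  · by_contra hne
    have h1 := Nat.nth_mem_of_infinite infinite_kept (n - 1)
    exact h (exists_primitive_of_not_exceptional ha h1.1 h1.2 hne)
  · rintro ⟨p, hp, hpk, hj⟩
    obtain ⟨j, h1, h2, h3, h4, h5⟩ := not_primitive_of_exceptional h hp hpk
    exact hj j h1 h2 h3 h4 h5

theorem failureSet_two :
    failureSet (removeTwoModFour fun k => conjNorm 2 (X ^ k - 1)) = {3} := by
  ext n
  rw [mem_failureSet_iff (by norm_num), Set.mem_singleton_iff]
  have h3 : Nat.count (fun k => 1 ≤ k ∧ k % 4 ≠ 2) 4 + 1 = 3 := by decide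
  constructor
  · rintro ⟨hn, ⟨-, h⟩ | ⟨h, -⟩⟩
    · rwa [nth_kept_eq_iff hn (by decide), h3] at h
    · norm_num at h
  · rintro rfl
    exact ⟨by norm_num, Or.inl ⟨rfl, (nth_kept_eq_iff (by norm_num) (by decide)).2 h3.symm⟩⟩

theorem failureSet_one :
    failureSet (removeTwoModFour fun k => conjNorm 1 (X ^ k - 1)) = {1, 9, 15, 18} := by
  ext n
  rw [mem_failureSet_iff le_rfl]
  simp only [exceptionalIndices, Set.mem_ofPred_eq, Set.mem_insert_iff, Set.mem_singleton_iff]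
  have h1 : Nat.count (fun k => 1 ≤ k ∧ k % 4 ≠ 2) 1 + 1 = 1 := by decide
  have h2 : Nat.count (fun k => 1 ≤ k ∧ k % 4 ≠ 2) 12 + 1 = 9 := by decide
  have h3 : Nat.count (fun k => 1 ≤ k ∧ k % 4 ≠ 2) 20 + 1 = 15 := by decide
  have h4 : Nat.count (fun k => 1 ≤ k ∧ k % 4 ≠ 2) 24 + 1 = 18 := by decide
  by_cases hn : 1 ≤ n
  · rw [nth_kept_eq_iff (k := 1) hn (by decide), nth_kept_eq_iff (k := 12) hn (by decide),
      nth_kept_eq_iff (k := 20) hn (by decide), nth_kept_eq_iff (k := 24) hn (by decide), h1, h2,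
      h3, h4]
    simp [hn]
  · simp only [hn, false_and, false_iff]
    omega

theorem failureSet_eq_empty {a : ℤ} (ha : 3 ≤ a) :
    failureSet (removeTwoModFour fun k => conjNorm a (X ^ k - 1)) = ∅ := by
  ext n
  rw [mem_failureSet_iff (by omega)]
  simp only [exceptionalIndices, Set.mem_ofPred_eq, Set.mem_empty_iff_false, iff_false]
  omega

theorem zsigmondyBound_of_isGreatest {A : ℕ → ℤ} {n : ℕ} (hfin : (failureSet A).Finite)
    (h : IsGreatest (failureSet A) n) : zsigmondyBound A = n := by
  unfold zsigmondyBound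
  rw [if_neg (Set.not_infinite.2 hfin), if_neg (Set.Nonempty.ne_empty ⟨n, h.1⟩), h.csSup_eq]

theorem zsigmondyBound_of_failureSet_eq_empty {A : ℕ → ℤ} (h : failureSet A = ∅) :
    zsigmondyBound A = 1 := by
  unfold zsigmondyBound
  rw [if_neg (by rw [h]; exact Set.not_infinite.2 Set.finite_empty), if_pos h]

/-! ### From the unit `u` to its trace `a` -/

theorem finrank_QSqrt_le_two (d : ℕ) : Module.finrank ℚ (QSqrt d) ≤ 2 := by
  have h0 : aeval √(d : ℝ) (X ^ 2 - C (d : ℚ)) = 0 := by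
    simp [Real.sq_sqrt (Nat.cast_nonneg d)]
  have hm : (X ^ 2 - C (d : ℚ)).Monic := monic_X_pow_sub_C _ two_ne_zero
  rw [IntermediateField.adjoin.finrank ⟨_, hm, by simp⟩]
  calc _ ≤ (X ^ 2 - C (d : ℚ)).natDegree :=
        natDegree_le_of_dvd (minpoly.dvd ℚ _ h0) hm.ne_zero
    _ = 2 := natDegree_X_pow_sub_C

/-- An element `u` of norm `-1` of a ring free of rank two over `ℤ` satisfies `u² = 1 + a u`, where
`a` is its trace, and the norms of the `u ^ n - 1` are those of `QuadraticAlgebra ℤ 1 a`. -/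
theorem exists_conjNorm_eq_norm {S : Type*} [CommRing S] (b : Module.Basis (Fin 2) ℤ S) {u : S}
    (hu : Algebra.norm ℤ u = -1) :
    ∃ a : ℤ, u * u = 1 + a * u ∧
      ∀ n : ℕ, Algebra.norm ℤ (u ^ n - 1) = conjNorm a (X ^ n - 1) := by
  set M := Algebra.leftMulMatrix b u with hM
  have hdet : M 0 0 * M 1 1 - M 0 1 * M 1 0 = -1 := by
    rw [← Matrix.det_fin_two, hM, ← Algebra.norm_eq_matrix_det, hu]
  -- Cayley–Hamilton for the 2×2 matrix of multiplication by `u`, whose determinant is -1.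
  have huu : u * u = (1 : ℤ) • (1 : S) + (M 0 0 + M 1 1) • u := by
    apply Algebra.leftMulMatrix_injective b
    rw [map_mul, map_add, map_smul, map_smul, map_one, ← hM]
    ext i j
    fin_cases i <;> fin_cases j <;>
      simp [Matrix.mul_apply, Fin.sum_univ_two, -zsmul_eq_mul] <;> linarith
  refine ⟨M 0 0 + M 1 1, by simpa using huu, fun n => ?_⟩
  let φ := QuadraticAlgebra.lift (R := ℤ) (a := 1) (b := M 0 0 + M 1 1) ⟨u, huu⟩
  have hφ : φ ω = u := by simp [φ, QuadraticAlgebra.lift]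
  have hnorm : ∀ z, Algebra.norm ℤ (φ z) = QuadraticAlgebra.norm z := by
    intro z
    have hz : φ z = z.re • (1 : S) + z.im • u := by
      simp [φ, QuadraticAlgebra.lift, Algebra.smul_def]
    rw [hz, Algebra.norm_eq_matrix_det b, map_add, map_smul, map_smul, map_one, ← hM,
      Matrix.det_fin_two, QuadraticAlgebra.norm_def]
    simp only [Matrix.add_apply, Matrix.smul_apply, smul_eq_mul, Matrix.one_apply]
    norm_num
    linear_combination z.im ^ 2 * hdet
  rw [conjNorm, ← hnorm, ← aeval_algHom_apply φ ω, hφ]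
  simp

theorem eq_neg_one_of_norm_eq_neg_one {S : Type*} [CommRing S] (b : Module.Basis (Fin 1) ℤ S)
    {u : S} (hu : Algebra.norm ℤ u = -1) : u = -1 := by
  rw [Algebra.norm_eq_matrix_det b, Matrix.det_fin_one] at hu
  apply Algebra.leftMulMatrix_injective b
  rw [map_neg, map_one]
  ext i j
  fin_cases i; fin_cases j
  simpa using hu

theorem exists_trace (d : ℕ) (u : (𝓞 (QSqrt d))ˣ)
    (hu : Algebra.norm ℤ (u : 𝓞 (QSqrt d)) = -1) (x : ℝ)
    (hx : x = (((u : 𝓞 (QSqrt d)) : QSqrt d) : ℝ)) (hx1 : 1 < x) :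
    ∃ a : ℤ, 1 ≤ a ∧ x ^ 2 = 1 + a * x ∧
      lehmerPierce (u : 𝓞 (QSqrt d)) = fun n => conjNorm a (X ^ n - 1) := by
  have hrank := NumberField.RingOfIntegers.rank (QSqrt d)
  have hle := finrank_QSqrt_le_two d
  have hpos : 0 < Module.finrank ℚ (QSqrt d) := Module.finrank_pos
  rw [← hrank] at hle hpos
  rcases (by omega : Module.finrank ℤ (𝓞 (QSqrt d)) = 1 ∨ Module.finrank ℤ (𝓞 (QSqrt d)) = 2)
    with h | h
  -- Rank one occurs for `d = 1`, where `K = ℚ`; norm -1 then forces `u = -1`, against `u > 1`.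
  · have hu1 := eq_neg_one_of_norm_eq_neg_one (Module.finBasisOfFinrankEq ℤ _ h) hu
    rw [hu1] at hx
    simp at hx
    linarith
  · obtain ⟨a, h1, h2⟩ := exists_conjNorm_eq_norm (Module.finBasisOfFinrankEq ℤ _ h) hu
    have hxx : x ^ 2 = 1 + a * x := by
      have := congrArg (fun y : 𝓞 (QSqrt d) => ((y : QSqrt d) : ℝ)) h1
      simp only [map_mul, map_add, map_one, map_intCast] at this
      rw [pow_two, hx]
      exact_mod_cast this
    refine ⟨a, ?_, hxx, funext h2⟩
    have : (0 : ℝ) < a := by by_contra h0; nlinarith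
    exact_mod_cast this

theorem theorem3p2 (d : ℕ) (hd_pos : 0 < d) (hd : Squarefree d)
    (u : (𝓞 (QSqrt d))ˣ)
    (hu_norm : Algebra.norm ℤ (u : 𝓞 (QSqrt d)) = -1)
    (x : ℝ) (hx : x = (((u : 𝓞 (QSqrt d)) : QSqrt d) : ℝ)) (hx_one : 1 < x)
    (Δ' : ℕ → ℤ) (hΔ' : Δ' = removeTwoModFour (lehmerPierce (u : 𝓞 (QSqrt d)))) :
    (13 < x → zsigmondyBound Δ' ≤ 4) ∧
    (x ≤ 13 →
      (x = 1 + √2 ∧ zsigmondyBound Δ' = 3 ∧ failureSet Δ' = {3}) ∨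
      (x = (1 + √5) / 2 ∧ zsigmondyBound Δ' = 18 ∧ failureSet Δ' = {1, 9, 15, 18}) ∨
      (x ≠ 1 + √2 ∧ x ≠ (1 + √5) / 2 ∧ zsigmondyBound Δ' = 1 ∧ failureSet Δ' = ∅)) := by
  obtain ⟨a, ha, hxx, hA⟩ := exists_trace d u hu_norm x hx hx_one
  rw [hA] at hΔ'
  have hs2 : √2 ^ 2 = (2 : ℝ) := Real.sq_sqrt (by norm_num)
  have hs5 : √5 ^ 2 = (5 : ℝ) := Real.sq_sqrt (by norm_num)
  have hs2' : 0 ≤ √(2 : ℝ) := Real.sqrt_nonneg _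
  have hs5' : 0 ≤ √(5 : ℝ) := Real.sqrt_nonneg _
  have hx0 : x ≠ 0 := by linarith
  rcases (by omega : a = 1 ∨ a = 2 ∨ 3 ≤ a) with rfl | rfl | ha3
  · refine ⟨fun h => by push_cast at hxx; nlinarith, fun _ => Or.inr (Or.inl ⟨?_, ?_, ?_⟩)⟩
    · push_cast at hxx
      nlinarith
    · have hset := hΔ' ▸ failureSet_one
      exact_mod_cast zsigmondyBound_of_isGreatest (n := 18) (by rw [hset]; exact Set.toFinite _)
        (by rw [hset]; exact ⟨by simp, by intro m hm; simp at hm; omega⟩)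
    · rw [hΔ', failureSet_one]
  · refine ⟨fun h => by push_cast at hxx; nlinarith, fun _ => Or.inl ⟨?_, ?_, ?_⟩⟩
    · push_cast at hxx
      nlinarith
    · have hset := hΔ' ▸ failureSet_two
      exact_mod_cast zsigmondyBound_of_isGreatest (n := 3) (by rw [hset]; exact Set.toFinite _)
        (by rw [hset]; exact isGreatest_singleton)
    · rw [hΔ', failureSet_two]
  -- For `a ≥ 3` nothing fails on either side of 13, so the bound 4 holds because `Z = 1`.
  · have hset : failureSet Δ' = ∅ := by rw [hΔ', failureSet_eq_empty ha3]
    have hz := zsigmondyBound_of_failureSet_eq_empty hset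
    refine ⟨fun _ => by rw [hz]; norm_num, fun _ => Or.inr (Or.inr ⟨?_, ?_, hz, hset⟩)⟩
    · intro h
      have : (a : ℝ) = 2 := mul_right_cancel₀ hx0 (by rw [h] at hxx ⊢; linear_combination hs2 - hxx)
      have : a = 2 := by exact_mod_cast this
      omega
    · intro h
      have : (a : ℝ) = 1 := mul_right_cancel₀ hx0
        (by rw [h] at hxx ⊢; linear_combination (1 / 4) * hs5 - hxx)
      have : a = 1 := by exact_mod_cast this
      omega
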